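/- For a topological group $G$, a minimal $G$-flow is a nonempty compact Hausdorff space $X$ (its phase space) with a continuous left action $G\times X\to X$ all of whose orbits are dense. A universal minimal flow of $G$ is a minimal $G$-flow that admits a continuous $G$-equivariant map onto every minimal $G$-flow; it is unique up to isomorphism and is denoted by $M(G)$. Theorem 5.1. Let $G$ be a totally disconnected locally compact topological group and let $K$ be a normal compact open subgroup of $G$. Then universal minimal flows $M(G)$ of $G$ and $M(G/K)$ of the quotient group $G/K$ exist, and the phase space of $M(G)$ (for any choice of $M(G)$ and $M(G/K)$) is homeomorphic to the product $M(G/K)\times K$ of the phase space of $M(G/K)$ with $K$. -/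

import Mathlib

universe u

/-- The topological space `X` with the given action of `G` is a minimal `G`-flow: `X` is a nonempty
compact Hausdorff space, the action `G × X → X` is (jointly) continuous, and every orbit is dense
(equivalently, `X` has no proper nonempty closed invariant subset). -/
structure IsMinimalFlow (G X : Type u) [Group G] [TopologicalSpace G]
    [TopologicalSpace X] [MulAction G X] : Prop where
  nonempty : Nonempty X
  compactSpace : CompactSpace X
  t2Space : T2Space X
  continuousSMul : ContinuousSMul G X
  isMinimal : MulAction.IsMinimal G X

/-- `X` is (a copy of) the universal minimal flow `M(G)`: it is a minimal `G`-flow that admits a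
homomorphism (a continuous equivariant map) onto every minimal `G`-flow. Testing against flows in
the universe of `G` loses nothing: a minimal flow is the image of the space of ultrafilters
on `G`, so it has a copy in that universe. -/
structure IsUniversalMinimalFlow (G X : Type u) [Group G] [TopologicalSpace G]
    [TopologicalSpace X] [MulAction G X] : Prop where
  isMinimalFlow : IsMinimalFlow G X
  exists_hom : ∀ (Y : Type u) [TopologicalSpace Y] [MulAction G Y], IsMinimalFlow G Y →
    ∃ φ : X →[G] Y, Continuous φ ∧ Function.Surjective φ

/-!
Put `D = G ⧸ K`, a discrete group, and let `s : D → G` be a section of the quotient map. Every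
element of `G` is uniquely `k * s d` with `k ∈ K`, and in these coordinates left multiplication is
`g * (k * s d) = (g * k * g⁻¹ * c) * s (g * d)`, where `c = g * s d * (s (g * d))⁻¹` lies in `K`.
Since `K` is compact, `d ↦ c` extends to the space `Ultrafilter D`, the Stone–Čech
compactification of `D`, so that `G` acts on `K × Ultrafilter D` (`CosetAmbit`). The subgroup `K`
acts by left multiplication on the first factor (`CosetAmbit.coe_smul`), and since `K` is open the
action is jointly continuous (`CosetAmbit.continuousSMul`).

Take a minimal subflow `M` of `Ultrafilter D`. As `K` is transitive on the fibres of
`K × Ultrafilter D → Ultrafilter D`, the preimage `K × M` is a minimal `G`-flow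
(`CosetAmbit.isMinimal_preimage`). Orbit maps extend from `D` to `Ultrafilter D` and from `G` to
`K × Ultrafilter D`, so `M` and `K × M` are universal (`IsMinimalFlow.isUniversal_of_ambit`).

The assertion about arbitrary universal minimal flows follows from their uniqueness
(`IsUniversalMinimalFlow.nonempty_homeomorph`), which rests on coalescence
(`IsUniversalMinimalFlow.injective_of_continuous`), proved by means of the enveloping semigroup.
-/

/-! ### Minimal subflows -/

theorem MulAction.exists_isMinimal_subMulAction {G A : Type*} [Group G] [TopologicalSpace A]
    [CompactSpace A] [MulAction G A] [ContinuousConstSMul G A] {S : Set A} (hS : IsClosed S)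
    (hne : S.Nonempty) (hinv : ∀ g : G, ∀ x ∈ S, g • x ∈ S) :
    ∃ M : SubMulAction G A, IsClosed (M : Set A) ∧ (M : Set A).Nonempty ∧ (M : Set A) ⊆ S ∧
      MulAction.IsMinimal G M := by
  obtain ⟨N, hN⟩ := zorn_superset
      {N : Set A | IsClosed N ∧ N.Nonempty ∧ N ⊆ S ∧ ∀ g : G, ∀ x ∈ N, g • x ∈ N} (by
    intro c hc hchain
    rcases c.eq_empty_or_nonempty with rfl | hcne
    · exact ⟨S, ⟨hS, hne, subset_rfl, hinv⟩, by simp⟩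
    · refine ⟨⋂₀ c, ⟨isClosed_sInter fun s hs => (hc hs).1, ?_, ?_, ?_⟩,
        fun s hs => Set.sInter_subset_of_mem hs⟩
      · have := hcne.to_subtype
        rw [Set.sInter_eq_iInter]
        exact IsCompact.nonempty_iInter_of_directed_nonempty_isCompact_isClosed _
          (fun s t => (hchain.total s.2 t.2).elim (fun h => ⟨s, subset_rfl, h⟩)
            fun h => ⟨t, h, subset_rfl⟩) (fun s => (hc s.2).2.1)
          (fun s => (hc s.2).1.isCompact) (fun s => (hc s.2).1)
      · obtain ⟨s, hs⟩ := hcne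
        exact (Set.sInter_subset_of_mem hs).trans (hc hs).2.2.1
      · exact fun g x hx s hs => (hc hs).2.2.2 g x (hx s hs))
  obtain ⟨⟨hcl, hnon, hsub, hsmul⟩, hmin⟩ := hN
  let M : SubMulAction G A := ⟨N, fun g {x} hx => hsmul g x hx⟩
  have hemb : Topology.IsClosedEmbedding ((↑) : M → A) := hcl.isClosedEmbedding_subtypeVal
  have : ContinuousConstSMul G M :=
    ⟨fun g => ((continuous_const_smul g).comp continuous_subtype_val).subtype_mk _⟩
  refine ⟨M, hcl, hnon, hsub, (isMinimal_iff_isClosed_smul_invariant G).2 fun s hs hgs => ?_⟩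
  rcases s.eq_empty_or_nonempty with h | h
  · exact Or.inl h
  · refine Or.inr (Set.eq_univ_of_forall fun x => ?_)
    have hle : N ⊆ ((↑) : M → A) '' s :=
      hmin ⟨hemb.isClosedMap s hs, h.image _, by rintro _ ⟨y, -, rfl⟩; exact hsub y.2, by
        rintro g _ ⟨y, hy, rfl⟩
        exact ⟨g • y, hgs g (Set.smul_mem_smul_set hy), rfl⟩⟩ (by
          rintro _ ⟨y, -, rfl⟩; exact y.2)
    obtain ⟨y, hy, hyx⟩ := hle x.2
    exact Subtype.ext hyx ▸ hy

theorem MulActionHom.surjective_of_isMinimal {G A B : Type*} [Group G] [TopologicalSpace A]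
    [CompactSpace A] [Nonempty A] [MulAction G A] [TopologicalSpace B] [T2Space B] [MulAction G B]
    [MulAction.IsMinimal G B] (φ : A →[G] B) (hφ : Continuous φ) : Function.Surjective φ := by
  rw [← Set.range_eq_univ]
  refine (eq_empty_or_univ_of_smul_invariant_closed G (isCompact_range hφ).isClosed
    fun g => ?_).resolve_left (Set.range_nonempty φ).ne_empty
  rintro _ ⟨_, ⟨a, rfl⟩, rfl⟩
  exact ⟨g • a, map_smul φ g a⟩

theorem IsMinimalFlow.of_isClosed {G A : Type u} [Group G] [TopologicalSpace G]
    [TopologicalSpace A] [CompactSpace A] [T2Space A] [MulAction G A] [ContinuousSMul G A]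
    (M : SubMulAction G A) (hcl : IsClosed (M : Set A)) (hne : (M : Set A).Nonempty)
    (hmin : MulAction.IsMinimal G M) : IsMinimalFlow G M where
  nonempty := hne.to_subtype
  compactSpace := isCompact_iff_compactSpace.1 hcl.isCompact
  t2Space := inferInstance
  continuousSMul := inferInstance
  isMinimal := hmin

/-- A minimal subflow of a flow that maps to every minimal flow is universal. -/
theorem IsMinimalFlow.isUniversal_of_ambit {G A : Type u} [Group G] [TopologicalSpace G]
    [TopologicalSpace A] [MulAction G A] {M : SubMulAction G A} (hM : IsMinimalFlow G M)
    (hA : ∀ (Y : Type u) [TopologicalSpace Y] [MulAction G Y], IsMinimalFlow G Y →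
      ∃ φ : A →[G] Y, Continuous φ) : IsUniversalMinimalFlow G M where
  isMinimalFlow := hM
  exists_hom Y _ _ hY := by
    obtain ⟨φ, hφ⟩ := hA Y hY
    have := hM.compactSpace
    have := hM.nonempty
    have := hY.t2Space
    have := hY.isMinimal
    have hc : Continuous (φ.comp M.inclusion) := hφ.comp continuous_subtype_val
    exact ⟨φ.comp M.inclusion, hc, (φ.comp M.inclusion).surjective_of_isMinimal hc⟩

/-! ### Uniqueness of the universal minimal flow -/

/-- In a left simple semigroup, an idempotent is a right identity, and right translations are
injective. -/
theorem mul_right_injective_of_left_simple {S : Type*} [Semigroup S]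
    (hS : ∀ a b : S, ∃ c, c * a = b) {u : S} (hu : u * u = u) :
    (∀ p, p * u = p) ∧ ∀ a, Function.Injective fun p : S => p * a := by
  have hpu : ∀ p, p * u = p := fun p => by
    obtain ⟨q, rfl⟩ := hS u p
    rw [mul_assoc, hu]
  refine ⟨hpu, fun a => ?_⟩
  obtain ⟨b, hb⟩ := hS a u
  obtain ⟨c, hc⟩ := hS b u
  have hcua : c = u * a := calc
    c = c * (b * a) := by rw [hb, hpu]
    _ = u * a := by rw [← mul_assoc, hc]
  refine Function.LeftInverse.injective (g := fun p => p * b) fun p => ?_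
  calc p * a * b = p * (u * a * b) := by rw [← mul_assoc, ← mul_assoc, hpu]
    _ = p := by rw [← hcua, hc, hpu]

/-- A universal minimal flow is coalescent: its endomorphisms are injective. Let `N` be a minimal
left ideal of the enveloping semigroup of `X`, which is a minimal flow. An endomorphism `φ` fits
between an evaluation map `N → X` and a homomorphism `X → N`; the composite is an endomorphism of
`N`, hence right multiplication by an element of `N`, hence injective. -/
theorem IsUniversalMinimalFlow.injective_of_continuous {G X : Type u} [Group G]
    [TopologicalSpace G] [TopologicalSpace X] [MulAction G X] (hX : IsUniversalMinimalFlow G X)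
    (φ : X →[G] X) (hφ : Continuous φ) : Function.Injective φ := by
  obtain ⟨⟨hne, hcomp, hT2, hsmul, hmin⟩, hhom⟩ := hX
  -- `E` is the enveloping (Ellis) semigroup of `X`.
  let E : Set (X → X) := closure (Set.range fun (g : G) (x : X) => g • x)
  obtain ⟨N, hNcl, hNne, hNE, hNmin⟩ := MulAction.exists_isMinimal_subMulAction (G := G)
    (S := E) isClosed_closure ⟨_, subset_closure ⟨1, rfl⟩⟩ (by
      intro g f hf
      refine map_mem_closure (continuous_const_smul g) hf ?_
      rintro _ ⟨h, rfl⟩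
      exact ⟨g * h, funext fun x => mul_smul g h x⟩)
  have hNflow := IsMinimalFlow.of_isClosed N hNcl hNne hNmin
  have := hNflow.compactSpace
  have := hNflow.nonempty
  have hcompc : ∀ n : X → X, Continuous fun p : X → X => p ∘ n := fun n =>
    continuous_pi fun x => continuous_apply (n x)
  have hcomp_mem : ∀ p ∈ E, ∀ n ∈ N, p ∘ n ∈ N := fun p hp n hn => by
    refine closure_minimal (t := {p | p ∘ n ∈ (N : Set (X → X))}) ?_
      (hNcl.preimage (hcompc n)) hp
    rintro _ ⟨g, rfl⟩
    exact N.smul_mem g hn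
  let : Semigroup N :=
    { mul := fun p q => ⟨p.1 ∘ q.1, hcomp_mem _ (hNE p.2) _ q.2⟩
      mul_assoc := fun _ _ _ => rfl }
  have hmulc : ∀ r : N, Continuous (· * r) := fun r =>
    ((hcompc r.1).comp continuous_subtype_val).subtype_mk _
  -- Right multiplication by `a` is an endomorphism of the minimal flow `N`.
  have hsimple : ∀ a b : N, ∃ c, c * a = b := fun a =>
    (MulActionHom.surjective_of_isMinimal (G := G)
      { toFun := fun c : N => c * a, map_smul' := fun _ _ => rfl } (hmulc a))
  obtain ⟨u, hu⟩ := exists_idempotent_of_compact_t2_of_continuous_mul_left hmulc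
  obtain ⟨hpu, hinj⟩ := mul_right_injective_of_left_simple hsimple hu
  have hright : ∀ (α : N →[G] N), Continuous α → ∀ p, α p = p * α u := fun α hα p => by
    -- `α` commutes with left composition by group elements, hence by their limits.
    have h : Set.EqOn (fun q : {q : X → X // q ∈ E} =>
        α ⟨q.1 ∘ u.1, hcomp_mem _ q.2 _ u.2⟩)
        (fun q => ⟨q.1 ∘ (α u).1, hcomp_mem _ q.2 _ (α u).2⟩)
        (closure ((↑) ⁻¹' Set.range fun (g : G) (x : X) => g • x)) := by
      refine Set.EqOn.closure ?_ (hα.comp (((hcompc _).comp continuous_subtype_val).subtype_mk _))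
        (((hcompc _).comp continuous_subtype_val).subtype_mk _)
      rintro ⟨_, _⟩ ⟨g, rfl⟩
      exact map_smul α g u
    have hp := h (x := ⟨p.1, hNE p.2⟩) (closure_subtype.2 (by
      convert! hNE p.2
      rw [Subtype.image_preimage_coe]
      exact Set.inter_eq_right.2 subset_closure))
    calc α p = α (p * u) := by rw [hpu]
      _ = p * α u := hp
  obtain ⟨ψ, hψ, -⟩ := hhom N hNflow
  obtain ⟨x⟩ := hne
  let e : N →[G] X := { toFun := fun n => n.1 x, map_smul' := fun _ _ => rfl }
  have he : Continuous e := (continuous_apply x).comp continuous_subtype_val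
  have hα : Function.Injective ((ψ.comp φ).comp e) := by
    have : ⇑((ψ.comp φ).comp e) = fun p => p * ((ψ.comp φ).comp e) u :=
      funext (hright _ (hψ.comp (hφ.comp he)))
    rw [this]
    exact hinj _
  intro a b hab
  obtain ⟨p, rfl⟩ := e.surjective_of_isMinimal he a
  obtain ⟨q, rfl⟩ := e.surjective_of_isMinimal he b
  exact congrArg e (hα (congrArg ψ hab))

theorem IsUniversalMinimalFlow.nonempty_homeomorph {G X Y : Type u} [Group G]
    [TopologicalSpace G] [TopologicalSpace X] [MulAction G X] [TopologicalSpace Y] [MulAction G Y]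
    (hX : IsUniversalMinimalFlow G X) (hY : IsUniversalMinimalFlow G Y) : Nonempty (X ≃ₜ Y) := by
  obtain ⟨f, hf, hfs⟩ := hX.exists_hom Y hY.isMinimalFlow
  obtain ⟨g, hg, -⟩ := hY.exists_hom X hX.isMinimalFlow
  have hinj : Function.Injective f := fun a b hab =>
    hX.injective_of_continuous (g.comp f) (hg.comp hf) (congrArg g hab)
  have := hX.isMinimalFlow.compactSpace
  have := hY.isMinimalFlow.t2Space
  exact ⟨Continuous.homeoOfEquivCompactToT2 (f := Equiv.ofBijective f ⟨hinj, hfs⟩) hf⟩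

/-! ### The ambit of a discrete group -/

/-- The action of a monoid on its ultrafilters extending left translation. -/
instance Ultrafilter.instMulActionTranslate (D : Type*) [Monoid D] :
    MulAction D (Ultrafilter D) where
  smul d p := p.map (d * ·)
  one_smul p := by
    change p.map (1 * ·) = p
    simp only [one_mul]
    exact p.map_id
  mul_smul d e p := by
    change p.map (d * e * ·) = (p.map (e * ·)).map (d * ·)
    simp only [Ultrafilter.map_map, Function.comp_def, mul_assoc]

theorem Ultrafilter.smul_pure {D : Type*} [Monoid D] (d e : D) :
    d • (pure e : Ultrafilter D) = pure (d * e) :=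
  Ultrafilter.map_pure _ _

instance Ultrafilter.instContinuousConstSMul (D : Type*) [Monoid D] :
    ContinuousConstSMul D (Ultrafilter D) where
  continuous_const_smul d := by
    refine ultrafilterBasis_is_basis.continuous_iff.2 ?_
    rintro _ ⟨s, rfl⟩
    exact ultrafilter_isOpen_basic ((d * ·) ⁻¹' s)

instance Ultrafilter.instContinuousSMulOfDiscrete (D : Type*) [Monoid D] [TopologicalSpace D]
    [DiscreteTopology D] : ContinuousSMul D (Ultrafilter D) :=
  ⟨continuous_prod_of_discrete_left.mpr continuous_const_smul⟩

theorem Ultrafilter.funext_of_continuous {D A : Type*} [TopologicalSpace A] [T2Space A]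
    {f g : Ultrafilter D → A} (hf : Continuous f) (hg : Continuous g)
    (h : ∀ d, f (pure d) = g (pure d)) (p : Ultrafilter D) : f p = g p :=
  congrFun (denseRange_pure.equalizer hf hg (funext h)) p

theorem Ultrafilter.extend_pure {D A : Type*} [TopologicalSpace A] [T2Space A]
    (f : D → A) (d : D) : Ultrafilter.extend f (pure d) = f d :=
  congrFun (ultrafilter_extend_extends f) d

/-- The orbit map of a point extends to the ultrafilters, so `Ultrafilter D` maps to every minimal
`D`-flow. -/
theorem Ultrafilter.exists_hom_to_minimalFlow {D : Type u} [Group D] [TopologicalSpace D]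
    (Y : Type u) [TopologicalSpace Y] [MulAction D Y] (hY : IsMinimalFlow D Y) :
    ∃ φ : Ultrafilter D →[D] Y, Continuous φ := by
  obtain ⟨⟨y⟩, _, _, _, -⟩ := hY
  have hc := continuous_ultrafilter_extend fun d : D => d • y
  refine ⟨⟨Ultrafilter.extend fun d : D => d • y, fun d p => ?_⟩, hc⟩
  refine Ultrafilter.funext_of_continuous (hc.comp (continuous_const_smul d))
    (g := fun p => d • Ultrafilter.extend (fun d : D => d • y) p) (hc.const_smul d)
    (fun e => ?_) p
  simp only [Function.comp_apply, Ultrafilter.smul_pure, Ultrafilter.extend_pure, mul_smul]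

/-! ### The ambit of an extension of a discrete group by a compact group -/

section CosetAmbit

variable {G : Type u} [Group G] (K : Subgroup G) [K.Normal]

/-- The `K`-valued cocycle of the (arbitrary) section `Quotient.out` of `G → G ⧸ K`: the element
`c` with `g * d.out = c * (g * d).out`. -/
noncomputable def cosetCocycle (g : G) (d : G ⧸ K) : K :=
  ⟨g * d.out * ((g : G ⧸ K) * d).out⁻¹, by
    rw [← QuotientGroup.eq_one_iff]
    simp⟩

theorem cosetCocycle_mul (g h : G) (d : G ⧸ K) :
    cosetCocycle K (g * h) d =
      MulAut.conjNormal g (cosetCocycle K h d) * cosetCocycle K g ((h : G ⧸ K) * d) := by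
  apply Subtype.ext
  simp [cosetCocycle, MulAut.conjNormal_apply, mul_assoc]

theorem cosetCocycle_coe (k : K) (d : G ⧸ K) : cosetCocycle K (k : G) d = k := by
  apply Subtype.ext
  simp [cosetCocycle, (QuotientGroup.eq_one_iff (k : G)).2 k.2]

/-- The greatest ambit of `G` when `K` is compact, open and normal: the pair `(k, d)` with `d` a
coset stands for the group element `k * d.out`. It carries the product topology, and the action of
`G` is the continuous extension of left multiplication read through this parametrization. -/
abbrev CosetAmbit : Type u := K × Ultrafilter (G ⧸ K)

namespace CosetAmbit

variable [TopologicalSpace G]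

theorem continuous_conjNormal [IsTopologicalGroup G] (g : G) : Continuous (MulAut.conjNormal g : K → K) :=
  Continuous.subtype_mk (f := fun k : K => g * k * g⁻¹) (by fun_prop) _

/-- From `g * (k * d.out) = (g * k * g⁻¹) * (g * d.out)`: conjugation on the `K`-coordinate,
corrected by the cocycle extended from `G ⧸ K` to its ultrafilters. -/
noncomputable instance : SMul G (CosetAmbit K) where
  smul g z :=
    (MulAut.conjNormal g z.1 * Ultrafilter.extend (cosetCocycle K g) z.2, (g : G ⧸ K) • z.2)

theorem smul_def (g : G) (z : CosetAmbit K) :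
    g • z = (MulAut.conjNormal g z.1 * Ultrafilter.extend (cosetCocycle K g) z.2,
      (g : G ⧸ K) • z.2) := rfl

variable [T2Space G] [CompactSpace K]

theorem extend_cosetCocycle_mul [IsTopologicalGroup G] (g h : G) (p : Ultrafilter (G ⧸ K)) :
    Ultrafilter.extend (cosetCocycle K (g * h)) p =
      MulAut.conjNormal g (Ultrafilter.extend (cosetCocycle K h) p) *
        Ultrafilter.extend (cosetCocycle K g) ((h : G ⧸ K) • p) := by
  refine Ultrafilter.funext_of_continuous (continuous_ultrafilter_extend _)
    (g := fun p => MulAut.conjNormal g (Ultrafilter.extend (cosetCocycle K h) p) *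
      Ultrafilter.extend (cosetCocycle K g) ((h : G ⧸ K) • p))
    (((continuous_conjNormal K g).comp (continuous_ultrafilter_extend _)).mul
      ((continuous_ultrafilter_extend _).comp (continuous_const_smul _))) (fun d => ?_) p
  simp only [Ultrafilter.smul_pure, Ultrafilter.extend_pure, cosetCocycle_mul]

theorem extend_cosetCocycle_coe (k : K) (p : Ultrafilter (G ⧸ K)) :
    Ultrafilter.extend (cosetCocycle K (k : G)) p = k :=
  Ultrafilter.funext_of_continuous (continuous_ultrafilter_extend _) continuous_const
    (fun d => by rw [Ultrafilter.extend_pure, cosetCocycle_coe]) p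

/-- `K` acts freely, by left multiplication on the first coordinate. -/
theorem coe_smul (k : K) (z : CosetAmbit K) : (k : G) • z = (k * z.1, z.2) := by
  refine Prod.ext ?_ ?_
  · rw [smul_def, extend_cosetCocycle_coe]
    apply Subtype.ext
    simp [MulAut.conjNormal_apply]
  · rw [smul_def, (QuotientGroup.eq_one_iff (k : G)).2 k.2, one_smul]

variable [IsTopologicalGroup G]

noncomputable instance : MulAction G (CosetAmbit K) where
  one_smul z := by
    have h := coe_smul K 1 z
    rwa [one_mul] at h
  mul_smul g h z := by
    refine Prod.ext ?_ ?_
    · simp only [smul_def, extend_cosetCocycle_mul, map_mul, MulAut.mul_apply, mul_assoc]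
    · simp only [smul_def, QuotientGroup.mk_mul, mul_smul]

instance : ContinuousConstSMul G (CosetAmbit K) where
  continuous_const_smul g :=
    (((continuous_conjNormal K g).comp continuous_fst).mul
      ((continuous_ultrafilter_extend _).comp continuous_snd)).prodMk
      (continuous_snd.const_smul (g : G ⧸ K))

/-- Each single group element acts continuously, and near `g` every group element is `g * k` with
`k ∈ K`, which acts jointly continuously by `coe_smul`; so the whole action is jointly
continuous. -/
theorem continuousSMul (hK : IsOpen (K : Set G)) : ContinuousSMul G (CosetAmbit K) := by
  refine ⟨continuous_iff_continuousAt.2 fun ⟨g, z⟩ => ?_⟩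
  have hemb : Topology.IsOpenEmbedding
      (Prod.map (fun k : K => g * (k : G)) (id : CosetAmbit K → CosetAmbit K)) :=
    ((Homeomorph.mulLeft g).isOpenEmbedding.comp hK.isOpenEmbedding_subtypeVal).prodMap
      Topology.IsOpenEmbedding.id
  have hat := hemb.continuousAt_iff (g := fun x : G × CosetAmbit K => x.1 • x.2) (x := (1, z))
  rw [Prod.map_apply, id, OneMemClass.coe_one, mul_one] at hat
  refine hat.1 (Continuous.continuousAt ?_)
  have heq : (fun x : G × CosetAmbit K => x.1 • x.2) ∘
      (Prod.map (fun k : K => g * (k : G)) (id : CosetAmbit K → CosetAmbit K)) =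
      fun x : K × CosetAmbit K => g • ((x.1 * x.2.1, x.2.2) : CosetAmbit K) := by
    funext x
    change (g * (x.1 : G)) • x.2 = _
    rw [mul_smul, coe_smul]
  rw [heq]
  refine (continuous_const_smul (T := CosetAmbit K) g).comp ?_
  exact (continuous_fst.mul (continuous_fst.comp continuous_snd)).prodMk
    (continuous_snd.comp continuous_snd)

/-- For a point `y` of a minimal flow, the map `k * d.out ↦ (k * d.out) • y` extends to
`CosetAmbit K`. -/
theorem exists_hom_to_minimalFlow (Y : Type u) [TopologicalSpace Y] [MulAction G Y]
    (hY : IsMinimalFlow G Y) : ∃ φ : CosetAmbit K →[G] Y, Continuous φ := by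
  obtain ⟨⟨y⟩, _, _, _, -⟩ := hY
  have hc := continuous_ultrafilter_extend fun d : G ⧸ K => d.out • y
  let F : CosetAmbit K → Y := fun z =>
    (z.1 : G) • Ultrafilter.extend (fun d : G ⧸ K => d.out • y) z.2
  have hF : Continuous F :=
    (continuous_subtype_val.comp continuous_fst).smul (hc.comp continuous_snd)
  refine ⟨⟨F, fun g z => ?_⟩, hF⟩
  obtain ⟨k, p⟩ := z
  have hk : Continuous fun p : Ultrafilter (G ⧸ K) => ((k, p) : CosetAmbit K) :=
    Continuous.prodMk_right k
  refine Ultrafilter.funext_of_continuous (f := fun p => F (g • ((k, p) : CosetAmbit K)))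
    (g := fun p => g • F (k, p)) (hF.comp (hk.const_smul g))
    ((hF.comp hk).const_smul g) (fun d => ?_) p
  simp only [smul_def, Ultrafilter.smul_pure, F, Ultrafilter.extend_pure]
  rw [← mul_smul, ← mul_smul, ← mul_smul]
  congr 1
  simp [cosetCocycle, MulAut.conjNormal_apply, mul_assoc]

/-- The subflow of `CosetAmbit K` lying over a subflow of `Ultrafilter (G ⧸ K)`. -/
def preimage (M : SubMulAction (G ⧸ K) (Ultrafilter (G ⧸ K))) : SubMulAction G (CosetAmbit K) where
  carrier := {z | z.2 ∈ M}
  smul_mem' g _ hz := M.smul_mem (g : G ⧸ K) hz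

/-- The preimage of `M` in the product `CosetAmbit K` is `M × K`, up to order of the factors. -/
def preimageHomeomorph (M : SubMulAction (G ⧸ K) (Ultrafilter (G ⧸ K))) :
    preimage K M ≃ₜ M × K where
  toFun z := (⟨z.1.2, z.2⟩, z.1.1)
  invFun w := ⟨(w.2, w.1.1), w.1.2⟩
  left_inv _ := rfl
  right_inv _ := rfl
  continuous_toFun := ((continuous_snd.comp continuous_subtype_val).subtype_mk _).prodMk
    (continuous_fst.comp continuous_subtype_val)
  continuous_invFun := Continuous.subtype_mk (continuous_snd.prodMk
    (continuous_subtype_val.comp continuous_fst) : Continuous fun w : M × K =>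
      ((w.2, w.1.1) : CosetAmbit K)) _

/-- A nonempty closed invariant subset projects onto `M`, and it contains whole fibres because
`K` acts transitively on them. -/
theorem isMinimal_preimage {M : SubMulAction (G ⧸ K) (Ultrafilter (G ⧸ K))}
    (hcl : IsClosed (M : Set (Ultrafilter (G ⧸ K)))) (hM : MulAction.IsMinimal (G ⧸ K) M) :
    MulAction.IsMinimal G (preimage K M) := by
  have : CompactSpace M := isCompact_iff_compactSpace.1 hcl.isCompact
  have : CompactSpace (preimage K M) := (preimageHomeomorph K M).symm.compactSpace
  have : ContinuousConstSMul G (preimage K M) :=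
    ⟨fun g => (continuous_subtype_val.const_smul g).subtype_mk _⟩
  refine (isMinimal_iff_isClosed_smul_invariant G).2 fun s hs hgs => ?_
  rcases s.eq_empty_or_nonempty with h | h
  · exact Or.inl h
  refine Or.inr (Set.eq_univ_of_forall fun z => ?_)
  let π : preimage K M → M := fun z => ⟨z.1.2, z.2⟩
  have hπ : Continuous π := (continuous_snd.comp continuous_subtype_val).subtype_mk _
  have himage : π '' s = Set.univ :=
    (eq_empty_or_univ_of_smul_invariant_closed (G ⧸ K) (hs.isCompact.image hπ).isClosed
      (fun d => by
        obtain ⟨g, rfl⟩ := QuotientGroup.mk_surjective d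
        rintro _ ⟨_, ⟨w, hw, rfl⟩, rfl⟩
        exact ⟨g • w, hgs g (Set.smul_mem_smul_set hw), rfl⟩)).resolve_left
      (h.image π).ne_empty
  obtain ⟨w, hw, hwz⟩ := himage.ge (Set.mem_univ (π z))
  -- `w` lies in the same fibre as `z`, so an element of `K` moves `w` to `z`.
  have hz : ((z.1.1 * w.1.1⁻¹ : K) : G) • w = z := by
    apply Subtype.ext
    rw [SubMulAction.val_smul, coe_smul]
    exact Prod.ext (inv_mul_cancel_right _ _) (congrArg Subtype.val hwz)
  exact hz ▸ hgs _ (Set.smul_mem_smul_set hw)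

end CosetAmbit

end CosetAmbit

theorem theorem5p1 {G : Type u} [Group G] [TopologicalSpace G] [IsTopologicalGroup G]
    [LocallyCompactSpace G] [TotallyDisconnectedSpace G]
    (K : Subgroup G) [K.Normal] (hKc : IsCompact (K : Set G)) (hKo : IsOpen (K : Set G)) :
    (∃ (X : Type u) (_ : TopologicalSpace X) (_ : MulAction G X),
      IsUniversalMinimalFlow G X) ∧
    (∃ (Y : Type u) (_ : TopologicalSpace Y) (_ : MulAction (G ⧸ K) Y),
      IsUniversalMinimalFlow (G ⧸ K) Y) ∧
    ∀ (X : Type u) [TopologicalSpace X] [MulAction G X]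
      (Y : Type u) [TopologicalSpace Y] [MulAction (G ⧸ K) Y],
      IsUniversalMinimalFlow G X → IsUniversalMinimalFlow (G ⧸ K) Y →
        Nonempty (X ≃ₜ Y × K) := by
  have : CompactSpace K := isCompact_iff_compactSpace.1 hKc
  have : DiscreteTopology (G ⧸ K) := QuotientGroup.discreteTopology hKo
  have : ContinuousSMul G (CosetAmbit K) := CosetAmbit.continuousSMul K hKo
  obtain ⟨M, hcl, hne, -, hmin⟩ := MulAction.exists_isMinimal_subMulAction (G := G ⧸ K)
    (isClosed_univ (X := Ultrafilter (G ⧸ K))) ⟨pure 1, trivial⟩ (fun _ _ _ => trivial)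
  have hM : IsUniversalMinimalFlow (G ⧸ K) M :=
    (IsMinimalFlow.of_isClosed M hcl hne hmin).isUniversal_of_ambit
      Ultrafilter.exists_hom_to_minimalFlow
  have hN : IsUniversalMinimalFlow G (CosetAmbit.preimage K M) :=
    (IsMinimalFlow.of_isClosed _ (hcl.preimage continuous_snd)
      (hne.elim fun p hp => ⟨((1, p) : K × Ultrafilter (G ⧸ K)), hp⟩)
      (CosetAmbit.isMinimal_preimage K hcl hmin)).isUniversal_of_ambit
      (CosetAmbit.exists_hom_to_minimalFlow K)
  refine ⟨⟨_, _, _, hN⟩, ⟨_, _, _, hM⟩, fun X _ _ Y _ _ hX hY => ?_⟩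
  obtain ⟨e⟩ := hX.nonempty_homeomorph hN
  obtain ⟨f⟩ := hM.nonempty_homeomorph hY
  exact ⟨e.trans ((CosetAmbit.preimageHomeomorph K M).trans
    (f.prodCongr (Homeomorph.refl K)))⟩
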